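/- **Setting.** FGG$^-$ is Featherweight Generic Go without type assertions. Types are $\tau ::= \alpha \mid t_S[\overline\tau] \mid t_I[\overline\tau]$ (type variable, struct type, interface type); expressions are $e ::= x \mid e.m[\overline\tau](\overline e) \mid t_S[\overline\tau]\{\overline e\} \mid e.f$; values $v$ are struct literals $t_S[\overline\tau]\{\overline v\}$ all of whose fields are values. A method signature $R$ is $m[\overline{\alpha\,\tau_I}](\overline{x\,\sigma})\,\sigma$. Declarations are $\mathsf{type}\ t_S[\overline{\alpha\,\tau_I}]\ \mathsf{struct}\{\overline{f\,\sigma}\}$, $\mathsf{type}\ t_I[\overline{\alpha\,\tau_I}]\ \mathsf{interface}\{\overline R\}$ and $\mathsf{func}\,(x\ t_S[\overline{\alpha\,\tau_I}])\,R\,\{\mathsf{return}\ e\}$, where every bound $\tau_I$ is an interface type and may mention the type parameters. Syntax is identified up to renaming of bound (type) variables. Fix a finite sequence of declarations $\overline D$. *Reduction.* $e \longrightarrow e'$ is the call-by-value, left-to-right small-step relation closed under evaluation contexts and generated by $t_S[\overline\tau]\{\overline v\}.f_i \longrightarrow v_i$ (where $f_i$ is the $i$-th field of $t_S$) and $v.m[\overline{\tau'}](\overline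 v) \longrightarrow \langle x:=v,\overline{x:=v}\rangle\langle\overline{\alpha:=\tau},\overline{\alpha':=\tau'}\rangle e$, where $v=t_S[\overline\tau]\{\overline u\}$ and $\overline D$ contains the method $m$ for $t_S$ with receiver $x$, receiver type parameters $\overline\alpha$, method type parameters $\overline{\alpha'}$, parameters $\overline x$ and body $e$. Write $e\longrightarrow^k e'$ for exactly $k$ steps; $e$ *diverges* if for all $k\in\mathbb N$ there is $e'$ with $e\longrightarrow^k e'$. *Typing and translation.* $\langle\Delta,\Gamma\rangle \vdash e:\tau\rightsquigarrow E$ is the type-directed dictionary-passing translation of $e$, at type $\tau$, to an expression $E$ of an untyped $\lambda$-calculus with constructors and pattern matching. It has rules for variables, struct literals (whose type must be well-formed), field accesses, method calls on struct types, method calls on interface types, and subsumption along $\Delta\vdash\tau<:\sigma\rightsquigarrow V$, which is structural subtyping with coercion function $V$: a type variable is below everything its bound is below, a struct type is below the interface types all of whose methods it implements, and an interface type is below another one if it has all the methods of the latter with the same signatures. Methods of struct types, calls and well-formed types require that type arguments are subtypes of the instantiated bounds. A closed value $v$ *has type* $\tau$ if $\langle\emptyset,\emptyset\rangle\vdash v:\tau\rightsquigarrow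 E'$ for some $E'$. *Well-formed declarations.* $\overline D$ is well-formed if every declaration is: struct and interface names are declared once, at most one method is declared for each struct name and method name, field names of a struct and method names of an interface are distinct, all bounds, field types and signatures are well-formed, and for a method for $t_S$ the struct $t_S$ is declared with equally many type parameters, the method set of each of its bounds being contained in that of the corresponding receiver bound; and if, moreover, every method body is translatable at its declared result type under the type and value environments given by its declaration. **Corollary (type soundness).** Let $\overline D$ be well-formed. Assume that in $e$ and in the bodies of the methods in $\overline D$ the type arguments $\overline{\tau'}$ of every method call $g.m[\overline{\tau'}](\overline g)$ are well-formed types (under $\emptyset$ and under the type environment of the method, respectively). If $$\langle\emptyset,\emptyset\rangle\vdash e:\tau\rightsquigarrow E$$ for some closed expression $e$, type $\tau$ and $E$, then either there are $k\in\mathbb N$ and a value $v$ of type $\tau$ with $e\longrightarrow^k v$, or $e$ diverges. -/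

import Mathlib

namespace FGG

/-!  Featherweight Generic Go without type assertions.

Syntax is identified up to renaming of bound variables and bound type variables, so it is
represented without names for them: a syntactic object is indexed by the type `V` of the type
variables and the type `X` of the expression variables that are in scope. A sequence of bounded
type parameters of length `n` binds `Fin n`; a nested sequence (of a method signature) extends the
scope `V` to `V ⊕ Fin p`. Binding the same name twice is thereby impossible. All other names
(struct, interface, field, method) are drawn from countably infinite sets; struct and interface
names are kept apart by the constructors of `Ty` and `Decl`. -/

abbrev StructName := ℕ
abbrev IfaceName := ℕ
abbrev FieldName := ℕ
abbrev MethodName := ℕ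

/-! ### Types, expressions, declarations -/

/-- Types: a type variable, a struct type `t_S[τ₁,…,τₙ]`, or an interface type `t_I[τ₁,…,τₙ]`. -/
inductive Ty (V : Type) : Type
  | var (α : V) : Ty V
  | struct (t : StructName) {n : ℕ} (args : Fin n → Ty V) : Ty V
  | iface (t : IfaceName) {n : ℕ} (args : Fin n → Ty V) : Ty V

/-- The syntactic subset of interface types, used for upper bounds. -/
structure IfaceTy (V : Type) : Type where
  name : IfaceName
  {arity : ℕ}
  args : Fin arity → Ty V

def IfaceTy.toTy {V : Type} (τ : IfaceTy V) : Ty V := .iface τ.name τ.args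

/-- Application of a (simultaneous) type substitution to a type. -/
def Ty.subst {V W : Type} (η : V → Ty W) : Ty V → Ty W
  | .var α => η α
  | .struct t args => .struct t (fun i => (args i).subst η)
  | .iface t args => .iface t (fun i => (args i).subst η)

def Ty.rename {V W : Type} (f : V → W) (τ : Ty V) : Ty W := τ.subst (fun α => .var (f α))

def IfaceTy.subst {V W : Type} (η : V → Ty W) (τ : IfaceTy V) : IfaceTy W :=
  ⟨τ.name, fun i => (τ.args i).subst η⟩

def IfaceTy.rename {V W : Type} (f : V → W) (τ : IfaceTy V) : IfaceTy W :=
  τ.subst (fun α => .var (f α))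

/-- Expressions with type variables `V` and variables `X`: variables, method calls
`e.m[τ₁,…](e₁,…)`, struct literals `t_S[τ₁,…]{e₁,…}` and field selections `e.f`. -/
inductive Expr (V X : Type) : Type
  | var (x : X) : Expr V X
  | call (e : Expr V X) (m : MethodName) {p : ℕ} (targs : Fin p → Ty V)
      {q : ℕ} (args : Fin q → Expr V X) : Expr V X
  | lit (t : StructName) {p : ℕ} (targs : Fin p → Ty V)
      {q : ℕ} (args : Fin q → Expr V X) : Expr V X
  | sel (e : Expr V X) (f : FieldName) : Expr V X

/-- Apply the type substitution `η`, and replace each variable `x` by `ρ x`. Expressions bind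
nothing, so there is no capture. -/
def Expr.subst {V W X Y : Type} (η : V → Ty W) (ρ : X → Expr W Y) : Expr V X → Expr W Y
  | .var x => ρ x
  | .call e m targs args =>
      .call (e.subst η ρ) m (fun i => (targs i).subst η) (fun i => (args i).subst η ρ)
  | .lit t targs args =>
      .lit t (fun i => (targs i).subst η) (fun i => (args i).subst η ρ)
  | .sel e f => .sel (e.subst η ρ) f

/-- Method signatures `m[α₁ τ₁, …](x₁ σ₁, …) σ`. The type parameters `Fin nTy` are in scope in all
bounds, in the parameter types and in the return type. Equality of signatures is equality up to
renaming of the type parameters and of the parameters. -/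
structure Sig (V : Type) : Type where
  name : MethodName
  nTy : ℕ
  bounds : Fin nTy → IfaceTy (V ⊕ Fin nTy)
  nArg : ℕ
  params : Fin nArg → Ty (V ⊕ Fin nTy)
  ret : Ty (V ⊕ Fin nTy)

/-- Extend a type substitution under the binder of `p` type parameters. -/
def liftSubst {V W : Type} (p : ℕ) (η : V → Ty W) : V ⊕ Fin p → Ty (W ⊕ Fin p) :=
  Sum.elim (fun α => (η α).rename Sum.inl) (fun j => .var (Sum.inr j))

/-- Capture-avoiding application of a type substitution to a signature. -/
def Sig.subst {V W : Type} (η : V → Ty W) (R : Sig V) : Sig W where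
  name := R.name
  nTy := R.nTy
  bounds i := (R.bounds i).subst (liftSubst R.nTy η)
  nArg := R.nArg
  params i := (R.params i).subst (liftSubst R.nTy η)
  ret := R.ret.subst (liftSubst R.nTy η)

/-- The type substitution that instantiates `p` type parameters by `targs`. -/
def inst {V : Type} {p : ℕ} (targs : Fin p → Ty V) : V ⊕ Fin p → Ty V := Sum.elim .var targs

/-- `type t_S[α₁ τ₁, …] struct { f₁ σ₁, … }` -/
structure StructDecl : Type where
  name : StructName
  n : ℕ
  bounds : Fin n → IfaceTy (Fin n)
  nFields : ℕ
  fieldName : Fin nFields → FieldName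
  fieldTy : Fin nFields → Ty (Fin n)

/-- `type t_I[α₁ τ₁, …] interface { R₁, … }` -/
structure IfaceDecl : Type where
  name : IfaceName
  n : ℕ
  bounds : Fin n → IfaceTy (Fin n)
  nMeth : ℕ
  sigs : Fin nMeth → Sig (Fin n)

/-- `func (x t_S[α₁ τ₁, …]) R { return e }`. In the body, the type variables are those of the
receiver (`inl`) and those of `R` (`inr`); the variable `none` is the receiver `x`, and `some k`
is the `k`-th parameter of `R`. -/
structure MethodDecl : Type where
  recv : StructName
  n : ℕ
  bounds : Fin n → IfaceTy (Fin n)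
  sig : Sig (Fin n)
  body : Expr (Fin n ⊕ Fin sig.nTy) (Option (Fin sig.nArg))

inductive Decl : Type
  | struct (d : StructDecl) : Decl
  | iface (d : IfaceDecl) : Decl
  | method (d : MethodDecl) : Decl

/-! ### Dynamic semantics -/

/-- Values are struct literals all of whose fields are values. -/
inductive IsValue {V X : Type} : Expr V X → Prop
  | lit (t : StructName) {p : ℕ} (targs : Fin p → Ty V) {q : ℕ} (args : Fin q → Expr V X) :
      (∀ i, IsValue (args i)) → IsValue (.lit t targs args)

/-- Call-by-value evaluation contexts. In `lit` and `callArg` the hole is in position `i` of the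
argument sequence: the entries before `i` are values, the entries after `i` are arbitrary, and the
entry of `args` at `i` itself is irrelevant (`fill` overwrites it). -/
inductive EvalCtx (V X : Type) : Type
  | hole : EvalCtx V X
  | lit (t : StructName) {p : ℕ} (targs : Fin p → Ty V) {q : ℕ} (args : Fin q → Expr V X)
      (i : Fin q) (hv : ∀ j, j < i → IsValue (args j)) (C : EvalCtx V X) : EvalCtx V X
  | sel (C : EvalCtx V X) (f : FieldName) : EvalCtx V X
  | callRecv (C : EvalCtx V X) (m : MethodName) {p : ℕ} (targs : Fin p → Ty V)
      {q : ℕ} (args : Fin q → Expr V X) : EvalCtx V X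
  | callArg (v : Expr V X) (hv : IsValue v) (m : MethodName) {p : ℕ} (targs : Fin p → Ty V)
      {q : ℕ} (args : Fin q → Expr V X) (i : Fin q) (hvs : ∀ j, j < i → IsValue (args j))
      (C : EvalCtx V X) : EvalCtx V X

/-- Replacement of the hole by an expression. -/
def EvalCtx.fill {V X : Type} (e : Expr V X) : EvalCtx V X → Expr V X
  | .hole => e
  | .lit t targs args i _ C => .lit t targs (Function.update args i (C.fill e))
  | .sel C f => .sel (C.fill e) f
  | .callRecv C m targs args => .call (C.fill e) m targs args
  | .callArg v _ m targs args i _ C => .call v m targs (Function.update args i (C.fill e))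

/-- The reduction relation for the declarations `D`. -/
inductive Step (D : List Decl) {V X : Type} : Expr V X → Expr V X → Prop
  | context (C : EvalCtx V X) {e e' : Expr V X} :
      Step D e e' → Step D (C.fill e) (C.fill e')
  | field (d : StructDecl) (hd : Decl.struct d ∈ D) {p : ℕ} (targs : Fin p → Ty V)
      (vs : Fin d.nFields → Expr V X) (hv : ∀ i, IsValue (vs i)) (i : Fin d.nFields) :
      Step D (.sel (.lit d.name targs vs) (d.fieldName i)) (vs i)
  | call (d : MethodDecl) (hd : Decl.method d ∈ D) (targs : Fin d.n → Ty V)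
      {q : ℕ} (us : Fin q → Expr V X) (hu : ∀ i, IsValue (us i))
      (targs' : Fin d.sig.nTy → Ty V)
      (vs : Fin d.sig.nArg → Expr V X) (hv : ∀ i, IsValue (vs i)) :
      Step D (.call (.lit d.recv targs us) d.sig.name targs' vs)
        (d.body.subst (Sum.elim targs targs') (fun x => x.elim (.lit d.recv targs us) vs))

/-- Reduction in exactly `k` steps. -/
def StepN (D : List Decl) {V X : Type} : ℕ → Expr V X → Expr V X → Prop
  | 0, e, e' => e = e'
  | k + 1, e, e' => ∃ e₁, Step D e e₁ ∧ StepN D k e₁ e'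

/-- Reduction in some number of steps. -/
def Reduces (D : List Decl) {V X : Type} (e e' : Expr V X) : Prop := ∃ k, StepN D k e e'

def Diverges (D : List Decl) {V X : Type} (e : Expr V X) : Prop := ∀ k, ∃ e', StepN D k e e'

/-! ### The target language

An untyped lambda calculus with constructors and pattern matching. `TL A` are the expressions with
free variables in `A`; a `lam` binds one variable, a clause `K X₁ … Xₘ → E` binds `m` of them. -/

/-- Constructors: countably many, among them a tuple constructor for every size. -/
inductive TLCon : Type
  | tuple (n : ℕ) : TLCon
  | named (k : ℕ) : TLCon

inductive TL : Type → Type 1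
  | var {A : Type} (a : A) : TL A
  | con {A : Type} (K : TLCon) : TL A
  | app {A : Type} (E G : TL A) : TL A
  | lam {A : Type} (E : TL (A ⊕ Fin 1)) : TL A
  | caseOf {A : Type} (E : TL A) {c : ℕ} (K : Fin c → TLCon) (distinct : Function.Injective K)
      (arity : Fin c → ℕ) (clause : ∀ i, TL (A ⊕ Fin (arity i))) : TL A

namespace TL

/-- Renaming of free variables. -/
def rename : {A B : Type} → (A → B) → TL A → TL B
  | _, _, f, .var a => .var (f a)
  | _, _, _, .con K => .con K
  | _, _, f, .app E G => .app (E.rename f) (G.rename f)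
  | _, _, f, .lam E => .lam (E.rename (Sum.map f id))
  | _, _, f, .caseOf E K h ar cl =>
      .caseOf (E.rename f) K h ar (fun i => (cl i).rename (Sum.map f id))

/-- The tuple expression `⟨E₁, …, Eₙ⟩`. -/
def tuple {A : Type} {n : ℕ} (E : Fin n → TL A) : TL A :=
  (List.ofFn E).foldl .app (.con (.tuple n))

/-- `case E of ⟨X₁, …, Xₙ⟩ → G` -/
def caseTuple {A : Type} (n : ℕ) (E : TL A) (G : TL (A ⊕ Fin n)) : TL A :=
  .caseOf (c := 1) E (fun _ => .tuple n) (fun _ _ _ => Subsingleton.elim _ _) (fun _ => n)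
    (fun _ => G)

/-- The function `λ ⟨X₁, …, Xₙ⟩. G` with a tuple pattern, that is
`λ X. case X of ⟨X₁, …, Xₙ⟩ → G` for a fresh `X`. -/
def lamTuple {A : Type} (n : ℕ) (G : TL (A ⊕ Fin n)) : TL A :=
  .lam (caseTuple n (.var (.inr 0)) (G.rename (Sum.map .inl id)))

/-- The nested pattern `case E of ⟨Y, ⟨X₁, …, X_q⟩⟩ → G`; in `G` the variable `Y` is `none` and
`Xⱼ` is `some j`. -/
def caseDict {A : Type} (q : ℕ) (E : TL A) (G : TL (A ⊕ Option (Fin q))) : TL A :=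
  caseTuple 2 E (caseTuple q (.var (.inr 1)) (G.rename
    (Sum.elim (fun a => .inl (.inl a)) (fun x => x.elim (.inl (.inr 0)) (fun j => .inr j)))))

/-- `λ ⟨Y, ⟨X₁, …, X_q⟩⟩. G` -/
def lamDict {A : Type} (q : ℕ) (G : TL (A ⊕ Option (Fin q))) : TL A :=
  .lam (caseDict q (.var (.inr 0)) (G.rename (Sum.map .inl id)))

end TL

/-- The target variables that are free in translations: the image `X` of a variable `x`, the
coercion variable `X_α` of a type variable `α`, and the let-bound variable `X_{m,t_S}`. -/
inductive TLVar (V X : Type) : Type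
  | exp (x : X) : TLVar V X
  | ty (α : V) : TLVar V X
  | meth (m : MethodName) (t : StructName) : TLVar V X

/-- Coercions contain no images of expression variables. -/
abbrev Coercion (V : Type) : Type 1 := TL (TLVar V Empty)

/-- Use a coercion inside an expression with variables `X`. -/
def Coercion.lift {V X : Type} (C : Coercion V) : TL (TLVar V X) :=
  TL.rename (fun a => match a with
    | .exp x => x.elim
    | .ty α => .ty α
    | .meth m t => .meth m t) C

/-! ### Static semantics and translation

The declarations `D` are a parameter of all judgments. -/

/-- Type environments assign an upper bound to every type variable in scope. -/
abbrev TyEnv (V : Type) : Type := V → IfaceTy V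

/-- The environment `Δ ∪ {β₁ : τ₁, …, β_p : τ_p}`. -/
def TyEnv.extend {V : Type} (Δ : TyEnv V) {p : ℕ} (bounds : Fin p → IfaceTy (V ⊕ Fin p)) :
    TyEnv (V ⊕ Fin p) :=
  Sum.elim (fun α => (Δ α).rename Sum.inl) bounds

/-- `methods(t_I[τ₁,…]) = {R₁, …, R_q}`, in order of declaration. -/
inductive MethodSpecs (D : List Decl) {V : Type} : Ty V → {q : ℕ} → (Fin q → Sig V) → Prop
  | mk (d : IfaceDecl) (hd : Decl.iface d ∈ D) (targs : Fin d.n → Ty V) :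
      MethodSpecs D (.iface d.name targs) (fun i => (d.sigs i).subst targs)

mutual

/-- `Δ ⊢ τ <: σ ⇝ C`: translation of structural subtyping. -/
inductive Upcast (D : List Decl) {V : Type} (Δ : TyEnv V) : Ty V → Ty V → Coercion V → Prop
  | tyvar (α : V) (σ : Ty V) (C : Coercion V) :
      Upcast D Δ (Δ α).toTy σ C →
      Upcast D Δ (.var α) σ
        (.lam (.app (C.rename Sum.inl) (.app (.var (.inl (.ty α))) (.var (.inr 0)))))
  | structIface (t : StructName) {k : ℕ} (targs : Fin k → Ty V) (σ : Ty V)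
      {n : ℕ} (R : Fin n → Sig V) (C : Fin n → Coercion V) :
      MethodSpecs D σ R →
      (∀ i, Methods D Δ (R i) (.struct t targs) (C i)) →
      Upcast D Δ (.struct t targs) σ
        (.lam (.tuple ![.var (.inr 0), .tuple (fun i =>
          .lamTuple 3 (.app (.var (.inl (.inl (.meth (R i).name t))))
            (.tuple ![(C i).rename (fun a => .inl (.inl a)),
              .var (.inr 0), .var (.inr 1), .var (.inr 2)])))]))
  | ifaceIface (τ σ : Ty V) {n q : ℕ} (R : Fin n → Sig V) (R' : Fin q → Sig V)
      (π : Fin q → Fin n) :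
      MethodSpecs D τ R → MethodSpecs D σ R' → (∀ i, R' i = R (π i)) →
      Upcast D Δ τ σ
        (.lamDict n (.tuple ![.var (.inr none),
          .tuple (fun i => .var (.inr (some (π i))))]))

/-- Instantiation of bounded type parameters: the actual types `targs` conform to the upper
`bounds`, to which the instantiating substitution has already been applied; the result is the tuple
of the coercions. -/
inductive TypeInst (D : List Decl) {V : Type} (Δ : TyEnv V) :
    {n : ℕ} → (bounds targs : Fin n → Ty V) → Coercion V → Prop
  | mk {n : ℕ} (bounds targs : Fin n → Ty V) (C : Fin n → Coercion V) :
      (∀ i, Upcast D Δ (targs i) (bounds i) (C i)) →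
      TypeInst D Δ bounds targs (.tuple C)

/-- `⟨R, C⟩ ∈ methods(Δ, t_S[τ₁,…])`: the method signature `R` is available for a struct type. -/
inductive Methods (D : List Decl) {V : Type} (Δ : TyEnv V) : Sig V → Ty V → Coercion V → Prop
  | mk (d : MethodDecl) (hd : Decl.method d ∈ D) (targs : Fin d.n → Ty V) (C : Coercion V) :
      TypeInst D Δ (fun i => (d.bounds i).toTy.subst targs) targs C →
      Methods D Δ (d.sig.subst targs) (.struct d.recv targs) C

end

/-- `Δ ⊢ τ ok`: well-formedness of types. -/
inductive TyOk (D : List Decl) {V : Type} (Δ : TyEnv V) : Ty V → Prop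
  | tyvar (α : V) : TyOk D Δ (.var α)
  | struct (d : StructDecl) (hd : Decl.struct d ∈ D) (targs : Fin d.n → Ty V) (C : Coercion V) :
      (∀ i, TyOk D Δ (targs i)) →
      TypeInst D Δ (fun i => (d.bounds i).toTy.subst targs) targs C →
      TyOk D Δ (.struct d.name targs)
  | iface (d : IfaceDecl) (hd : Decl.iface d ∈ D) (targs : Fin d.n → Ty V) (C : Coercion V) :
      (∀ i, TyOk D Δ (targs i)) →
      TypeInst D Δ (fun i => (d.bounds i).toTy.subst targs) targs C →
      TyOk D Δ (.iface d.name targs)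

/-- `⟨Δ, Γ⟩ ⊢ e : τ ⇝ E`: typing and translation of expressions. -/
inductive ExpTrans (D : List Decl) {V X : Type} (Δ : TyEnv V) (Γ : X → Ty V) :
    Expr V X → Ty V → TL (TLVar V X) → Prop
  | var (x : X) : ExpTrans D Δ Γ (.var x) (Γ x) (.var (.exp x))
  | struct (d : StructDecl) (hd : Decl.struct d ∈ D) (targs : Fin d.n → Ty V)
      (args : Fin d.nFields → Expr V X) (E : Fin d.nFields → TL (TLVar V X)) :
      TyOk D Δ (.struct d.name targs) →
      (∀ i, ExpTrans D Δ Γ (args i) ((d.fieldTy i).subst targs) (E i)) →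
      ExpTrans D Δ Γ (.lit d.name targs args) (.struct d.name targs) (.tuple E)
  | access (d : StructDecl) (hd : Decl.struct d ∈ D) (targs : Fin d.n → Ty V)
      (e : Expr V X) (E : TL (TLVar V X)) (i : Fin d.nFields) :
      ExpTrans D Δ Γ e (.struct d.name targs) E →
      ExpTrans D Δ Γ (.sel e (d.fieldName i)) ((d.fieldTy i).subst targs)
        (.caseTuple d.nFields E (.var (.inr i)))
  | callStruct (e : Expr V X) (E : TL (TLVar V X)) (t : StructName) {k : ℕ}
      (targs : Fin k → Ty V) (R : Sig V) (C : Coercion V)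
      (targs' : Fin R.nTy → Ty V) (C' : Coercion V)
      (args : Fin R.nArg → Expr V X) (Es : Fin R.nArg → TL (TLVar V X)) :
      ExpTrans D Δ Γ e (.struct t targs) E →
      Methods D Δ R (.struct t targs) C →
      TypeInst D Δ (fun i => (R.bounds i).toTy.subst (inst targs')) targs' C' →
      (∀ i, ExpTrans D Δ Γ (args i) ((R.params i).subst (inst targs')) (Es i)) →
      ExpTrans D Δ Γ (.call e R.name targs' args) (R.ret.subst (inst targs'))
        (.app (.var (.meth R.name t)) (.tuple ![C.lift, E, C'.lift, .tuple Es]))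
  | callIface (e : Expr V X) (E : TL (TLVar V X)) (τ : Ty V) {q : ℕ} (R : Fin q → Sig V)
      (j : Fin q) (targs' : Fin (R j).nTy → Ty V) (C' : Coercion V)
      (args : Fin (R j).nArg → Expr V X) (Es : Fin (R j).nArg → TL (TLVar V X)) :
      ExpTrans D Δ Γ e τ E →
      MethodSpecs D τ R →
      TypeInst D Δ (fun i => ((R j).bounds i).toTy.subst (inst targs')) targs' C' →
      (∀ i, ExpTrans D Δ Γ (args i) (((R j).params i).subst (inst targs')) (Es i)) →
      ExpTrans D Δ Γ (.call e (R j).name targs' args) ((R j).ret.subst (inst targs'))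
        (.caseDict q E (.app (.var (.inr (some j)))
          (.tuple ![.var (.inr none), C'.lift.rename Sum.inl,
            .tuple (fun i => (Es i).rename Sum.inl)])))
  | sub (e : Expr V X) (E : TL (TLVar V X)) (τ σ : Ty V) (C : Coercion V) :
      ExpTrans D Δ Γ e τ E →
      Upcast D Δ τ σ C →
      ExpTrans D Δ Γ e σ (.app C.lift E)

/-- Well-formedness of bounded type parameters; `Δ` is the environment that already contains
them. -/
def FormalsOk (D : List Decl) {V : Type} (Δ : TyEnv V) {p : ℕ} (bounds : Fin p → IfaceTy V) :
    Prop :=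
  ∀ i, TyOk D Δ (bounds i).toTy

/-- `Δ ⊢ R ok`: well-formedness of method signatures. -/
structure SigOk (D : List Decl) {V : Type} (Δ : TyEnv V) (R : Sig V) : Prop where
  formals : FormalsOk D (Δ.extend R.bounds) R.bounds
  params : ∀ i, TyOk D (Δ.extend R.bounds) (R.params i)
  ret : TyOk D (Δ.extend R.bounds) R.ret

def Decl.isStruct (t : StructName) : Decl → Bool
  | .struct d => d.name == t
  | _ => false

def Decl.isIface (t : IfaceName) : Decl → Bool
  | .iface d => d.name == t
  | _ => false

def Decl.isMethod (t : StructName) (m : MethodName) : Decl → Bool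
  | .method d => d.recv == t && d.sig.name == m
  | _ => false

/-- `⊢ d ok`: well-formedness of declarations. -/
inductive DeclOk (D : List Decl) : Decl → Prop
  | struct (d : StructDecl) :
      D.countP (Decl.isStruct d.name) = 1 →
      FormalsOk D d.bounds d.bounds →
      (∀ i, TyOk D d.bounds (d.fieldTy i)) →
      Function.Injective d.fieldName →
      DeclOk D (.struct d)
  | iface (d : IfaceDecl) :
      D.countP (Decl.isIface d.name) = 1 →
      FormalsOk D d.bounds d.bounds →
      (∀ i, SigOk D d.bounds (d.sigs i)) →
      Function.Injective (fun i => (d.sigs i).name) →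
      DeclOk D (.iface d)
  | method (d : MethodDecl) (s : StructDecl) (hs : Decl.struct s ∈ D) (hn : s.n = d.n) :
      D.countP (Decl.isMethod d.recv d.sig.name) = 1 →
      FormalsOk D d.bounds d.bounds →
      SigOk D d.bounds d.sig →
      s.name = d.recv →
      (∀ i : Fin s.n, ∃ (q' q : ℕ) (R' : Fin q' → Sig (Fin d.n)) (R : Fin q → Sig (Fin d.n)),
        MethodSpecs D ((s.bounds i).rename (Fin.cast hn)).toTy R' ∧
        MethodSpecs D (d.bounds (Fin.cast hn i)).toTy R ∧
        Set.range R' ⊆ Set.range R) →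
      DeclOk D (.method d)

/-- The type environment of a method body. -/
def MethodDecl.tyEnv (d : MethodDecl) : TyEnv (Fin d.n ⊕ Fin d.sig.nTy) :=
  TyEnv.extend d.bounds d.sig.bounds

/-- The value environment of a method body. -/
def MethodDecl.valEnv (d : MethodDecl) :
    Option (Fin d.sig.nArg) → Ty (Fin d.n ⊕ Fin d.sig.nTy)
  | none => .struct d.recv (fun i => .var (Sum.inl i))
  | some k => d.sig.params k

/-- `⊢ d ⇝ X = V`: translation of a method declaration to the binding of `X_{m,t_S}` to
`λ ⟨⟨X_{α₁}, …⟩, X, ⟨X_{β₁}, …⟩, ⟨X₁, …⟩⟩. E`. -/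
inductive MethTrans (D : List Decl) :
    MethodDecl → TLVar Empty Empty → TL (TLVar Empty Empty) → Prop
  | mk (d : MethodDecl) (E : TL (TLVar (Fin d.n ⊕ Fin d.sig.nTy) (Option (Fin d.sig.nArg)))) :
      ExpTrans D d.tyEnv d.valEnv d.body d.sig.ret E →
      MethTrans D d (.meth d.sig.name d.recv)
        (.lamTuple 4
          (.caseTuple d.n (.var (.inr 0))
            (.caseTuple d.sig.nTy (.var (.inl (.inr 2)))
              (.caseTuple d.sig.nArg (.var (.inl (.inl (.inr 3))))
                (E.rename (fun a => match a with
                  | .ty (.inl i) => .inl (.inl (.inr i))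
                  | .exp none => .inl (.inl (.inl (.inr 1)))
                  | .ty (.inr j) => .inl (.inr j)
                  | .exp (some k) => .inr k
                  | .meth m t => .inl (.inl (.inl (.inl (.meth m t))))))))))

/-- The declarations are well-formed: every declaration is, and every method declaration
translates. -/
def DeclsOk (D : List Decl) : Prop :=
  (∀ d ∈ D, DeclOk D d) ∧ ∀ d, Decl.method d ∈ D → ∃ X C, MethTrans D d X C

/-- All type arguments of the method calls in an expression are well-formed types. -/
def Expr.CallTypeArgsOk (D : List Decl) {V X : Type} (Δ : TyEnv V) : Expr V X → Prop
  | .var _ => True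
  | .call e _ targs args =>
      e.CallTypeArgsOk D Δ ∧ (∀ i, TyOk D Δ (targs i)) ∧ ∀ i, (args i).CallTypeArgsOk D Δ
  | .lit _ _ args => ∀ i, (args i).CallTypeArgsOk D Δ
  | .sel e _ => e.CallTypeArgsOk D Δ

/-- The empty type environment. -/
def emptyTyEnv : TyEnv Empty := fun α => α.elim

/-- The empty value environment. -/
def emptyValEnv : Empty → Ty Empty := fun x => x.elim

end FGG

/-!
Type soundness is proved by progress and preservation, with the translations of the judgments
forgotten: `HasType` and `IsSubtype` assert that some target expression, or some coercion, exists.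

The point at which the structural type system needs work is subsumption. Every supertype is an
interface type, and whether a type is below an interface type depends only on the set of
signatures of the latter. As interface names are declared once, that set is determined by the type
(`MethodSpecs.range_eq`), which makes subtyping transitive (`Upcast.trans`). Transitivity makes
all static judgments stable under type substitutions that respect the bounds (`Conforms`,
`Upcast.subst`, `HasType.subst`): a type variable has the supertypes of its bound, and its
instance is below the instance of the bound. It also merges successive subsumption steps, so that
inversion of typing holds up to a single one (`HasType.lit_inv`, `HasType.sel_inv`,
`HasType.call_inv`). Finally, a value is a struct literal, and a struct type implements each
method that one of its supertypes offers (`Offers.of_subtype_struct`); hence a method call on a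
value, be it typed at a struct type or at an interface type, always finds a declaration of the
method, whose signature is the one used for typing and whose bounds are respected
(`HasType.lit_method`).

With the uniqueness of method declarations this gives `Step.preservation` and `HasType.progress`.
A struct literal is only typable at a well-formed type, so the substitution lemma needs
well-formed types in place of the type variables. For the receiver this follows from its typing,
and for the type arguments of the call it is the assumption `Expr.CallTypeArgsOk`, which reduction
preserves as well.
-/

namespace FGG

/-! ### Composition of substitutions -/

@[simp]
theorem Ty.subst_var {V : Type} (τ : Ty V) : τ.subst .var = τ := by
  induction τ <;> simp_all [Ty.subst]

theorem Ty.subst_subst {U V W : Type} (η : U → Ty V) (θ : V → Ty W) (τ : Ty U) :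
    (τ.subst η).subst θ = τ.subst (fun α => (η α).subst θ) := by
  induction τ <;> simp_all [Ty.subst]

theorem IfaceTy.toTy_subst {V W : Type} (η : V → Ty W) (τ : IfaceTy V) :
    (τ.subst η).toTy = τ.toTy.subst η := rfl

theorem liftSubst_subst {U V W : Type} (p : ℕ) (η : U → Ty V) (θ : V → Ty W) (x : U ⊕ Fin p) :
    (liftSubst p η x).subst (liftSubst p θ) = liftSubst p (fun α => (η α).subst θ) x := by
  cases x <;> simp [liftSubst, Ty.rename, Ty.subst_subst, Ty.subst]

theorem Sig.subst_subst {U V W : Type} (η : U → Ty V) (θ : V → Ty W) (R : Sig U) :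
    (R.subst η).subst θ = R.subst (fun α => (η α).subst θ) := by
  simp [Sig.subst, IfaceTy.subst, Ty.subst_subst, liftSubst_subst]

/-- Instantiating type parameters commutes with substitution for the type variables in scope. -/
theorem Ty.subst_inst_subst {V W : Type} {p : ℕ} (η : V → Ty W) (targs : Fin p → Ty V)
    (τ : Ty (V ⊕ Fin p)) :
    (τ.subst (inst targs)).subst η =
      (τ.subst (liftSubst p η)).subst (inst fun i => (targs i).subst η) := by
  rw [Ty.subst_subst, Ty.subst_subst]
  congr 1
  funext x
  cases x <;> simp [inst, liftSubst, Ty.subst, Ty.rename, Ty.subst_subst]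

theorem Ty.subst_liftSubst_inst {V W : Type} {p : ℕ} (η : V → Ty W) (targs : Fin p → Ty W)
    (τ : Ty (V ⊕ Fin p)) :
    (τ.subst (liftSubst p η)).subst (inst targs) = τ.subst (Sum.elim η targs) := by
  rw [Ty.subst_subst]
  congr 1
  funext x
  cases x <;> simp [inst, liftSubst, Ty.subst, Ty.rename, Ty.subst_subst]

/-! ### Uniqueness of declarations -/

theorem _root_.List.eq_of_countP_eq_one {α : Type*} {p : α → Bool} {l : List α}
    (h : l.countP p = 1) {a b : α} (ha : a ∈ l) (hb : b ∈ l) (hpa : p a) (hpb : p b) : a = b := by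
  rw [List.countP_eq_length_filter, List.length_eq_one_iff] at h
  obtain ⟨c, hc⟩ := h
  have ha' : a ∈ l.filter p := List.mem_filter.2 ⟨ha, hpa⟩
  have hb' : b ∈ l.filter p := List.mem_filter.2 ⟨hb, hpb⟩
  rw [hc, List.mem_singleton] at ha' hb'
  rw [ha', hb']

variable {D : List Decl}

theorem DeclsOk.struct_unique (hD : DeclsOk D) {d d' : StructDecl} (hd : Decl.struct d ∈ D)
    (hd' : Decl.struct d' ∈ D) (h : d.name = d'.name) : d = d' := by
  cases hD.1 _ hd with
  | struct _ hc _ _ _ =>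
    simpa using List.eq_of_countP_eq_one hc hd hd' (by simp [Decl.isStruct])
      (by simp [Decl.isStruct, h])

theorem DeclsOk.iface_unique (hD : DeclsOk D) {d d' : IfaceDecl} (hd : Decl.iface d ∈ D)
    (hd' : Decl.iface d' ∈ D) (h : d.name = d'.name) : d = d' := by
  cases hD.1 _ hd with
  | iface _ hc _ _ _ =>
    simpa using List.eq_of_countP_eq_one hc hd hd' (by simp [Decl.isIface])
      (by simp [Decl.isIface, h])

theorem DeclsOk.method_unique (hD : DeclsOk D) {d d' : MethodDecl} (hd : Decl.method d ∈ D)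
    (hd' : Decl.method d' ∈ D) (h : d.recv = d'.recv) (hm : d.sig.name = d'.sig.name) :
    d = d' := by
  cases hD.1 _ hd with
  | method _ _ _ _ hc _ _ _ _ =>
    simpa using List.eq_of_countP_eq_one hc hd hd' (by simp [Decl.isMethod])
      (by simp [Decl.isMethod, h, hm])

theorem DeclsOk.fieldName_injective (hD : DeclsOk D) {d : StructDecl} (hd : Decl.struct d ∈ D) :
    Function.Injective d.fieldName := by
  cases hD.1 _ hd with
  | struct _ _ _ _ h => exact h

/-! ### Subtyping -/

variable {V W X Y : Type} {Δ : TyEnv V} {Γ : X → Ty V}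

/-- Structural subtyping, regardless of the coercion. -/
def IsSubtype (D : List Decl) (Δ : TyEnv V) (τ σ : Ty V) : Prop := ∃ C, Upcast D Δ τ σ C

theorem MethodSpecs.subst {τ : Ty V} {q : ℕ} {R : Fin q → Sig V} (h : MethodSpecs D τ R)
    (η : V → Ty W) : MethodSpecs D (τ.subst η) (fun i => (R i).subst η) := by
  obtain ⟨d, hd, targs⟩ := h
  simp only [Sig.subst_subst]
  exact .mk d hd _

theorem MethodSpecs.range_eq (hD : DeclsOk D) {τ : Ty V} {q q' : ℕ} {R : Fin q → Sig V}
    {R' : Fin q' → Sig V} (h : MethodSpecs D τ R) (h' : MethodSpecs D τ R') :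
    Set.range R = Set.range R' := by
  generalize hσ : τ = σ at h'
  obtain ⟨d, hd, targs⟩ := h
  obtain ⟨d', hd', targs'⟩ := h'
  obtain rfl := hD.iface_unique hd hd' (by simp_all)
  simp_all

/-- Every supertype is an interface type. -/
theorem Upcast.exists_methodSpecs {τ σ : Ty V} {C : Coercion V} :
    Upcast D Δ τ σ C → ∃ (q : ℕ) (R : Fin q → Sig V), MethodSpecs D σ R
  | .tyvar _ _ _ h => h.exists_methodSpecs
  | .structIface _ _ _ _ _ h _ => ⟨_, _, h⟩
  | .ifaceIface _ _ _ _ _ _ h _ => ⟨_, _, h⟩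

theorem not_subtype_struct {τ : Ty V} {t : StructName} {n : ℕ} {targs : Fin n → Ty V} :
    ¬ IsSubtype D Δ τ (.struct t targs) := by
  rintro ⟨C, h⟩
  obtain ⟨q, R, h⟩ := h.exists_methodSpecs
  cases h

/-- A type offers a signature: a struct type, if it implements the method, an interface type, if
the signature is among those of the interface. Type variables offer nothing. -/
inductive Offers (D : List Decl) (Δ : TyEnv V) : Ty V → Sig V → Prop
  | struct {t : StructName} {k : ℕ} {targs : Fin k → Ty V} {R : Sig V} {C : Coercion V} :
      Methods D Δ R (.struct t targs) C → Offers D Δ (.struct t targs) R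
  | iface {τ : Ty V} {q : ℕ} {R : Fin q → Sig V} (j : Fin q) :
      MethodSpecs D τ R → Offers D Δ τ (R j)

theorem Offers.mem_range (hD : DeclsOk D) {τ : Ty V} {q : ℕ} {R : Fin q → Sig V} {S : Sig V}
    (h : Offers D Δ τ S) (hτ : MethodSpecs D τ R) : S ∈ Set.range R := by
  cases h with
  | struct h => cases hτ
  | iface j h => exact hτ.range_eq hD h ▸ Set.mem_range_self j

/-- A struct type implements everything that its supertypes offer. -/
theorem Offers.of_subtype_struct (hD : DeclsOk D) {t : StructName} {k : ℕ} {targs : Fin k → Ty V}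
    {σ : Ty V} {R : Sig V} (hsub : IsSubtype D Δ (.struct t targs) σ) (h : Offers D Δ σ R) :
    Offers D Δ (.struct t targs) R := by
  obtain ⟨C, hsub⟩ := hsub
  cases hsub with
  | structIface _ _ _ S C hS hC =>
    obtain ⟨j, rfl⟩ := h.mem_range hD hS
    exact .struct (hC j)
  | ifaceIface _ _ _ _ _ h => cases h

/-- The signatures of a supertype of an interface type are among those of the interface type. -/
theorem Upcast.exists_methodSpecs_mem_range (hD : DeclsOk D) {σ ρ : Ty V} {C : Coercion V} {n : ℕ}
    {R : Fin n → Sig V} (h : Upcast D Δ σ ρ C) (hR : MethodSpecs D σ R) :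
    ∃ (q : ℕ) (S : Fin q → Sig V), MethodSpecs D ρ S ∧ ∀ i, S i ∈ Set.range R := by
  cases h with
  | tyvar => cases hR
  | structIface => cases hR
  | ifaceIface _ _ R' S π hR' hS h =>
    exact ⟨_, S, hS, fun i => hR'.range_eq hD hR ▸ ⟨π i, (h i).symm⟩⟩

theorem Upcast.trans (hD : DeclsOk D) {τ σ ρ : Ty V} {C C' : Coercion V} :
    Upcast D Δ τ σ C → Upcast D Δ σ ρ C' → IsSubtype D Δ τ ρ
  | .tyvar _ _ _ h, h' => have ⟨_, h''⟩ := h.trans hD h'; ⟨_, .tyvar _ _ _ h''⟩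
  | .structIface _ _ _ _ C hR hC, h' => by
    obtain ⟨_, S, hS, hSR⟩ := h'.exists_methodSpecs_mem_range hD hR
    choose π hπ using hSR
    exact ⟨_, .structIface _ _ _ S (fun i => C (π i)) hS (fun i => hπ i ▸ hC (π i))⟩
  | .ifaceIface _ _ R _ π hR hS hπ, h' => by
    obtain ⟨_, T, hT, hTS⟩ := h'.exists_methodSpecs_mem_range hD hS
    choose θ hθ using hTS
    exact ⟨_, .ifaceIface _ _ R T (fun i => π (θ i)) hR hT
      (fun i => (hθ i).symm.trans (hπ (θ i)))⟩

theorem IsSubtype.trans (hD : DeclsOk D) {τ σ ρ : Ty V} (h : IsSubtype D Δ τ σ)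
    (h' : IsSubtype D Δ σ ρ) : IsSubtype D Δ τ ρ :=
  have ⟨_, h⟩ := h
  have ⟨_, h'⟩ := h'
  h.trans hD h'

theorem exists_typeInst {n : ℕ} {bounds targs : Fin n → Ty V} :
    (∃ C, TypeInst D Δ bounds targs C) ↔ ∀ i, IsSubtype D Δ (targs i) (bounds i) := by
  constructor
  · rintro ⟨_, ⟨_, _, C, h⟩⟩ i
    exact ⟨_, h i⟩
  · intro h
    choose C h using h
    exact ⟨_, .mk _ _ C h⟩

/-! ### Type substitution -/

/-- The substitution `η` respects the bounds of the type variables it replaces. -/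
def Conforms (D : List Decl) (Δ : TyEnv V) (Δ' : TyEnv W) (η : V → Ty W) : Prop :=
  ∀ α, IsSubtype D Δ' (η α) ((Δ α).toTy.subst η)

mutual

theorem Upcast.subst (hD : DeclsOk D) {Δ' : TyEnv W} {η : V → Ty W} (hη : Conforms D Δ Δ' η)
    {τ σ : Ty V} {C : Coercion V} :
    Upcast D Δ τ σ C → IsSubtype D Δ' (τ.subst η) (σ.subst η)
  | .tyvar α _ _ h => (hη α).trans hD (h.subst hD hη)
  | .structIface t targs _ R C hR hC => by
    have h i := (hC i).subst hD hη
    choose C' h using h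
    exact ⟨_, .structIface _ _ _ _ C' (hR.subst η) h⟩
  | .ifaceIface _ _ _ _ π hR hS hπ =>
    ⟨_, .ifaceIface _ _ _ _ π (hR.subst η) (hS.subst η) fun i => by rw [hπ]⟩

theorem TypeInst.subst (hD : DeclsOk D) {Δ' : TyEnv W} {η : V → Ty W} (hη : Conforms D Δ Δ' η)
    {n : ℕ} {bounds targs : Fin n → Ty V} {C : Coercion V} :
    TypeInst D Δ bounds targs C →
      ∃ C', TypeInst D Δ' (fun i => (bounds i).subst η) (fun i => (targs i).subst η) C'
  | .mk _ _ _ h => exists_typeInst.2 fun i => (h i).subst hD hη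

theorem Methods.subst (hD : DeclsOk D) {Δ' : TyEnv W} {η : V → Ty W} (hη : Conforms D Δ Δ' η)
    {R : Sig V} {τ : Ty V} {C : Coercion V} :
    Methods D Δ R τ C → ∃ C', Methods D Δ' (R.subst η) (τ.subst η) C'
  | .mk d hd targs C h => by
    obtain ⟨C', h'⟩ := h.subst hD hη
    simp only [Ty.subst_subst] at h'
    rw [Sig.subst_subst]
    exact ⟨_, .mk d hd _ C' h'⟩

end

theorem IsSubtype.subst (hD : DeclsOk D) {Δ' : TyEnv W} {η : V → Ty W} (hη : Conforms D Δ Δ' η)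
    {τ σ : Ty V} (h : IsSubtype D Δ τ σ) : IsSubtype D Δ' (τ.subst η) (σ.subst η) :=
  have ⟨_, h⟩ := h
  h.subst hD hη

theorem Offers.subst (hD : DeclsOk D) {Δ' : TyEnv W} {η : V → Ty W} (hη : Conforms D Δ Δ' η)
    {τ : Ty V} {R : Sig V} (h : Offers D Δ τ R) : Offers D Δ' (τ.subst η) (R.subst η) := by
  cases h with
  | struct h =>
    obtain ⟨C, h⟩ := h.subst hD hη
    exact .struct h
  | iface j h => exact .iface j (h.subst η)

theorem TyOk.subst (hD : DeclsOk D) {Δ' : TyEnv W} {η : V → Ty W} (hη : Conforms D Δ Δ' η)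
    (hok : ∀ α, TyOk D Δ' (η α)) {τ : Ty V} (h : TyOk D Δ τ) : TyOk D Δ' (τ.subst η) := by
  induction h with
  | tyvar α => exact hok α
  | struct d hd targs C _ hC ih =>
    obtain ⟨C', h'⟩ := hC.subst hD hη
    simp only [Ty.subst_subst] at h'
    exact .struct d hd _ C' ih h'
  | iface d hd targs C _ hC ih =>
    obtain ⟨C', h'⟩ := hC.subst hD hη
    simp only [Ty.subst_subst] at h'
    exact .iface d hd _ C' ih h'

/-! ### Typing -/

/-- Typing of expressions, regardless of the translation. -/
def HasType (D : List Decl) (Δ : TyEnv V) (Γ : X → Ty V) (e : Expr V X) (τ : Ty V) : Prop :=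
  ∃ E, ExpTrans D Δ Γ e τ E

theorem HasType.sub {e : Expr V X} {τ σ : Ty V} (h : HasType D Δ Γ e τ)
    (h' : Relation.ReflGen (IsSubtype D Δ) τ σ) : HasType D Δ Γ e σ := by
  obtain ⟨E, h⟩ := h
  cases h' with
  | refl => exact ⟨E, h⟩
  | single h' =>
    obtain ⟨C, h'⟩ := h'
    exact ⟨_, .sub _ _ _ _ _ h h'⟩

theorem HasType.lit {d : StructDecl} (hd : Decl.struct d ∈ D) {targs : Fin d.n → Ty V}
    {args : Fin d.nFields → Expr V X} (hok : TyOk D Δ (.struct d.name targs))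
    (hargs : ∀ i, HasType D Δ Γ (args i) ((d.fieldTy i).subst targs)) :
    HasType D Δ Γ (.lit d.name targs args) (.struct d.name targs) := by
  choose E hE using hargs
  exact ⟨_, .struct d hd targs args E hok hE⟩

theorem HasType.sel {d : StructDecl} (hd : Decl.struct d ∈ D) {targs : Fin d.n → Ty V}
    {e : Expr V X} (h : HasType D Δ Γ e (.struct d.name targs)) (i : Fin d.nFields) :
    HasType D Δ Γ (.sel e (d.fieldName i)) ((d.fieldTy i).subst targs) :=
  have ⟨E, h⟩ := h
  ⟨_, .access d hd targs e E i h⟩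

theorem HasType.call {e : Expr V X} {τ : Ty V} {R : Sig V} {targs : Fin R.nTy → Ty V}
    {args : Fin R.nArg → Expr V X} (h : HasType D Δ Γ e τ) (hR : Offers D Δ τ R)
    (hbounds : ∀ i, IsSubtype D Δ (targs i) ((R.bounds i).toTy.subst (inst targs)))
    (hargs : ∀ i, HasType D Δ Γ (args i) ((R.params i).subst (inst targs))) :
    HasType D Δ Γ (.call e R.name targs args) (R.ret.subst (inst targs)) := by
  obtain ⟨E, h⟩ := h
  obtain ⟨C', hC'⟩ := exists_typeInst.2 hbounds
  choose Es hEs using hargs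
  cases hR with
  | struct hR => exact ⟨_, .callStruct e E _ _ R _ targs C' args Es h hR hC' hEs⟩
  | iface j hR => exact ⟨_, .callIface e E _ _ j targs C' args Es h hR hC' hEs⟩

/-- Consecutive subsumption steps merge, so inversion of typing yields the rule for the head of the
expression followed by at most one of them. -/
theorem reflGen_isSubtype_trans (hD : DeclsOk D) {τ σ ρ : Ty V}
    (h : Relation.ReflGen (IsSubtype D Δ) τ σ) (h' : IsSubtype D Δ σ ρ) :
    Relation.ReflGen (IsSubtype D Δ) τ ρ := by
  cases h with
  | refl => exact .single h'
  | single h => exact .single (h.trans hD h')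

theorem HasType.lit_inv (hD : DeclsOk D) {t : StructName} {p q : ℕ} {targs : Fin p → Ty V}
    {args : Fin q → Expr V X} {τ : Ty V} (h : HasType D Δ Γ (.lit t targs args) τ) :
    ∃ (d : StructDecl) (targs' : Fin d.n → Ty V) (args' : Fin d.nFields → Expr V X),
      Decl.struct d ∈ D ∧ Expr.lit t targs args = .lit d.name targs' args' ∧
      TyOk D Δ (.struct d.name targs') ∧
      (∀ i, HasType D Δ Γ (args' i) ((d.fieldTy i).subst targs')) ∧
      Relation.ReflGen (IsSubtype D Δ) (.struct d.name targs') τ := by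
  obtain ⟨E, h⟩ := h
  generalize he : Expr.lit t targs args = e at h
  induction h with
  | struct d hd targs' args' E hok h =>
    exact ⟨d, targs', args', hd, rfl, hok, fun i => ⟨_, h i⟩, .refl⟩
  | sub e E τ σ C _ hsub ih =>
    obtain ⟨d, targs', args', hd, h₁, h₂, h₃, h₄⟩ := ih he
    exact ⟨d, targs', args', hd, h₁, h₂, h₃, reflGen_isSubtype_trans hD h₄ ⟨C, hsub⟩⟩
  | _ => cases he

theorem HasType.sel_inv (hD : DeclsOk D) {e : Expr V X} {f : FieldName} {τ : Ty V}
    (h : HasType D Δ Γ (.sel e f) τ) :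
    ∃ (d : StructDecl) (targs : Fin d.n → Ty V) (i : Fin d.nFields),
      Decl.struct d ∈ D ∧ f = d.fieldName i ∧ HasType D Δ Γ e (.struct d.name targs) ∧
      Relation.ReflGen (IsSubtype D Δ) ((d.fieldTy i).subst targs) τ := by
  obtain ⟨E, h⟩ := h
  generalize he : Expr.sel e f = e' at h
  induction h with
  | access d hd targs e₀ E i h =>
    cases he
    exact ⟨d, targs, i, hd, rfl, ⟨_, h⟩, .refl⟩
  | sub e E τ σ C _ hsub ih =>
    obtain ⟨d, targs, i, hd, h₁, h₂, h₃⟩ := ih he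
    exact ⟨d, targs, i, hd, h₁, h₂, reflGen_isSubtype_trans hD h₃ ⟨C, hsub⟩⟩
  | _ => cases he

theorem HasType.call_inv (hD : DeclsOk D) {e : Expr V X} {m : MethodName} {p q : ℕ}
    {targs : Fin p → Ty V} {args : Fin q → Expr V X} {τ : Ty V}
    (h : HasType D Δ Γ (.call e m targs args) τ) :
    ∃ (σ : Ty V) (R : Sig V) (targs' : Fin R.nTy → Ty V) (args' : Fin R.nArg → Expr V X),
      Expr.call e m targs args = .call e R.name targs' args' ∧
      HasType D Δ Γ e σ ∧ Offers D Δ σ R ∧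
      (∀ i, IsSubtype D Δ (targs' i) ((R.bounds i).toTy.subst (inst targs'))) ∧
      (∀ i, HasType D Δ Γ (args' i) ((R.params i).subst (inst targs'))) ∧
      Relation.ReflGen (IsSubtype D Δ) (R.ret.subst (inst targs')) τ := by
  obtain ⟨E, h⟩ := h
  generalize he : Expr.call e m targs args = e' at h
  induction h with
  | callStruct e₀ E t targs₀ R C targs' C' args' Es h hR hC' hEs =>
    obtain rfl : e = e₀ := by simp_all
    exact ⟨_, R, targs', args', rfl, ⟨_, h⟩, .struct hR, exists_typeInst.1 ⟨_, hC'⟩,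
      fun i => ⟨_, hEs i⟩, .refl⟩
  | callIface e₀ E τ R j targs' C' args' Es h hR hC' hEs =>
    obtain rfl : e = e₀ := by simp_all
    exact ⟨_, R j, targs', args', rfl, ⟨_, h⟩, .iface j hR, exists_typeInst.1 ⟨_, hC'⟩,
      fun i => ⟨_, hEs i⟩, .refl⟩
  | sub e E τ σ C _ hsub ih =>
    obtain ⟨σ', R, targs', args', h₁, h₂, h₃, h₄, h₅, h₆⟩ := ih he
    exact ⟨σ', R, targs', args', h₁, h₂, h₃, h₄, h₅, reflGen_isSubtype_trans hD h₆ ⟨C, hsub⟩⟩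
  | _ => cases he

/-- A struct literal that has some struct type has it by the typing rule for literals. -/
theorem HasType.lit_struct_inv (hD : DeclsOk D) {t : StructName} {p q : ℕ} {targs : Fin p → Ty V}
    {args : Fin q → Expr V X} {d : StructDecl} (hd : Decl.struct d ∈ D) {targs' : Fin d.n → Ty V}
    (h : HasType D Δ Γ (.lit t targs args) (.struct d.name targs')) :
    ∃ args' : Fin d.nFields → Expr V X,
      Expr.lit t targs args = .lit d.name targs' args' ∧
      ∀ i, HasType D Δ Γ (args' i) ((d.fieldTy i).subst targs') := by
  obtain ⟨d', targs₀, args₀, hd', he, -, hargs, hsub⟩ := h.lit_inv hD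
  generalize hσ : Ty.struct d.name targs' = σ at hsub
  cases hsub with
  | refl =>
    obtain rfl := hD.struct_unique hd hd' (by simp_all)
    obtain rfl : targs' = targs₀ := by simp_all
    exact ⟨args₀, he, hargs⟩
  | single hsub =>
    subst hσ
    exact (not_subtype_struct hsub).elim

/-- The substitution lemma: typing is stable under simultaneous substitution of conforming
well-formed types for type variables and of expressions of the right types for variables. -/
theorem HasType.subst (hD : DeclsOk D) {Δ' : TyEnv W} {Γ' : Y → Ty W} {η : V → Ty W}
    (hη : Conforms D Δ Δ' η) (hok : ∀ α, TyOk D Δ' (η α)) {ρ : X → Expr W Y}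
    (hρ : ∀ x, HasType D Δ' Γ' (ρ x) ((Γ x).subst η)) {e : Expr V X} {τ : Ty V}
    (h : HasType D Δ Γ e τ) : HasType D Δ' Γ' (e.subst η ρ) (τ.subst η) := by
  -- Both rules for method calls, from the induction hypotheses for the receiver and the arguments.
  have call (e : Expr V X) (σ : Ty V) (R : Sig V) (targs : Fin R.nTy → Ty V)
      (args : Fin R.nArg → Expr V X) (h : HasType D Δ' Γ' (e.subst η ρ) (σ.subst η))
      (hR : Offers D Δ σ R)
      (hb : ∀ i, IsSubtype D Δ (targs i) ((R.bounds i).toTy.subst (inst targs)))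
      (ha : ∀ i, HasType D Δ' Γ' ((args i).subst η ρ)
        (((R.params i).subst (inst targs)).subst η)) :
      HasType D Δ' Γ' ((Expr.call e R.name targs args).subst η ρ)
        ((R.ret.subst (inst targs)).subst η) := by
    simp only [Ty.subst_inst_subst] at ha ⊢
    refine HasType.call (R := R.subst η) h (hR.subst hD hη) (fun i => ?_) ha
    have hi := (hb i).subst hD hη
    rwa [Ty.subst_inst_subst] at hi
  obtain ⟨E, h⟩ := h
  induction h with
  | var x => exact hρ x
  | struct d hd targs args E h _ ih =>
    simp only [Ty.subst_subst] at ih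
    exact .lit hd (h.subst hD hη hok) ih
  | access d hd targs e E i _ ih =>
    rw [Ty.subst_subst]
    exact .sel hd ih i
  | callStruct e E t targs R C targs' C' args Es _ hR hC' _ ih iha =>
    exact call _ _ R _ _ ih (.struct hR) (exists_typeInst.1 ⟨_, hC'⟩) iha
  | callIface e E τ R j targs' C' args Es _ hR hC' _ ih iha =>
    exact call _ _ (R j) _ _ ih (.iface j hR) (exists_typeInst.1 ⟨_, hC'⟩) iha
  | sub e E τ σ C _ hsub ih => exact ih.sub (.single (hsub.subst hD hη))

theorem Expr.CallTypeArgsOk.subst (hD : DeclsOk D) {Δ' : TyEnv W} {η : V → Ty W}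
    (hη : Conforms D Δ Δ' η) (hok : ∀ α, TyOk D Δ' (η α)) {ρ : X → Expr W Y}
    (hρ : ∀ x, (ρ x).CallTypeArgsOk D Δ') {e : Expr V X} (h : e.CallTypeArgsOk D Δ) :
    (e.subst η ρ).CallTypeArgsOk D Δ' := by
  induction e with
  | var x => exact hρ x
  | call e m targs args ih iha =>
    exact ⟨ih h.1, fun i => (h.2.1 i).subst hD hη hok, fun i => iha i (h.2.2 i)⟩
  | lit t targs args ih => exact fun i => ih i (h i)
  | sel e f ih => exact ih h

theorem IsValue.callTypeArgsOk {v : Expr V X} (h : IsValue v) : v.CallTypeArgsOk D Δ := by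
  induction h with
  | lit _ _ _ _ ih => exact ih

/-! ### Preservation -/

theorem EvalCtx.callTypeArgsOk_fill (C : EvalCtx V X) {e : Expr V X}
    (h : (C.fill e).CallTypeArgsOk D Δ) : e.CallTypeArgsOk D Δ ∧
      ∀ e' : Expr V X, e'.CallTypeArgsOk D Δ → (C.fill e').CallTypeArgsOk D Δ := by
  induction C with
  | hole => exact ⟨h, fun _ => id⟩
  | lit t targs args i hv C ih =>
    obtain ⟨hi, ha⟩ := (Function.forall_update_iff args fun _ a => a.CallTypeArgsOk D Δ).1 h
    exact ⟨(ih hi).1, fun e' he' =>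
      (Function.forall_update_iff args fun _ a => a.CallTypeArgsOk D Δ).2 ⟨(ih hi).2 e' he', ha⟩⟩
  | sel C f ih => exact ih h
  | callRecv C m targs args ih => exact ⟨(ih h.1).1, fun e' he' => ⟨(ih h.1).2 e' he', h.2⟩⟩
  | callArg v hv m targs args i hvs C ih =>
    obtain ⟨hi, ha⟩ := (Function.forall_update_iff args fun _ a => a.CallTypeArgsOk D Δ).1 h.2.2
    exact ⟨(ih hi).1, fun e' he' => ⟨h.1, h.2.1,
      (Function.forall_update_iff args fun _ a => a.CallTypeArgsOk D Δ).2 ⟨(ih hi).2 e' he', ha⟩⟩⟩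

/-- The expression in the hole of a typed expression has some type, and any expression of that type
may take its place. -/
theorem EvalCtx.hasType_fill (hD : DeclsOk D) (C : EvalCtx V X) {e : Expr V X} {τ : Ty V}
    (h : HasType D Δ Γ (C.fill e) τ) : ∃ σ, HasType D Δ Γ e σ ∧
      ∀ e', HasType D Δ Γ e' σ → HasType D Δ Γ (C.fill e') τ := by
  induction C generalizing τ with
  | hole => exact ⟨τ, h, fun _ => id⟩
  | lit t targs args i hv C ih =>
    obtain ⟨d, targs', args', hd, he, hok, hargs, hsub⟩ := h.lit_inv hD
    cases he
    obtain ⟨hi, ha⟩ := (Function.forall_update_iff args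
      fun j a => HasType D Δ Γ a ((d.fieldTy j).subst targs')).1 hargs
    obtain ⟨σ, hσ, hfill⟩ := ih hi
    exact ⟨σ, hσ, fun e' he' => .sub (.lit hd hok ((Function.forall_update_iff args
      fun j a => HasType D Δ Γ a ((d.fieldTy j).subst targs')).2 ⟨hfill e' he', ha⟩)) hsub⟩
  | sel C f ih =>
    obtain ⟨d, targs, i, hd, rfl, he, hsub⟩ := h.sel_inv hD
    obtain ⟨σ, hσ, hfill⟩ := ih he
    exact ⟨σ, hσ, fun e' he' => .sub (.sel hd (hfill e' he') i) hsub⟩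
  | callRecv C m targs args ih =>
    obtain ⟨ρ, R, targs', args', he, hr, hR, hb, ha, hsub⟩ := h.call_inv hD
    cases he
    obtain ⟨σ, hσ, hfill⟩ := ih hr
    exact ⟨σ, hσ, fun e' he' => .sub (.call (hfill e' he') hR hb ha) hsub⟩
  | callArg v hv m targs args i hvs C ih =>
    obtain ⟨ρ, R, targs', args', he, hr, hR, hb, ha, hsub⟩ := h.call_inv hD
    cases he
    obtain ⟨hi, ha⟩ := (Function.forall_update_iff args
      fun j a => HasType D Δ Γ a ((R.params j).subst (inst targs'))).1 ha
    obtain ⟨σ, hσ, hfill⟩ := ih hi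
    exact ⟨σ, hσ, fun e' he' => .sub (.call hr hR hb ((Function.forall_update_iff args
      fun j a => HasType D Δ Γ a ((R.params j).subst (inst targs'))).2 ⟨hfill e' he', ha⟩)) hsub⟩

/-- The case of `HasType.lit_method` in which the signature is offered by the struct type of the
literal. The arities `p` and `q` are variables here so that the type can be matched against the
receiver type of the declaration. -/
theorem Offers.exists_methodDecl {t : StructName} {p q : ℕ} {targs : Fin p → Ty V}
    {args : Fin q → Expr V X} {R : Sig V} (hR : Offers D Δ (.struct t targs) R)
    (hok : ∀ i, TyOk D Δ (targs i)) (h : HasType D Δ Γ (.lit t targs args) (.struct t targs)) :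
    ∃ (d : MethodDecl) (targs' : Fin d.n → Ty V), Decl.method d ∈ D ∧
      Expr.lit t targs args = .lit d.recv targs' args ∧ R = d.sig.subst targs' ∧
      HasType D Δ Γ (.lit t targs args) (.struct d.recv targs') ∧
      (∀ i, TyOk D Δ (targs' i)) ∧
      ∀ i, IsSubtype D Δ (targs' i) ((d.bounds i).toTy.subst targs') := by
  cases hR with
  | struct hR =>
    obtain ⟨d, hd, targs, C, hC⟩ := hR
    exact ⟨d, targs, hd, rfl, rfl, h, hok, exists_typeInst.1 ⟨_, hC⟩⟩
  | iface _ h => cases h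

theorem TyOk.of_struct (hD : DeclsOk D) {s : StructDecl} (hs : Decl.struct s ∈ D)
    {targs : Fin s.n → Ty V} (h : TyOk D Δ (.struct s.name targs)) (i : Fin s.n) :
    TyOk D Δ (targs i) := by
  generalize hτ : Ty.struct s.name targs = τ at h
  cases h with
  | struct d hd targs' C h _ =>
    cases hD.struct_unique hs hd (by simp_all)
    cases hτ
    exact h i
  | _ => cases hτ

/-- If a struct literal has a type that offers the signature `R`, then `R` is the signature of a
method that is declared for the struct and whose receiver bounds the type arguments respect. -/
theorem HasType.lit_method (hD : DeclsOk D) {t : StructName} {p q : ℕ} {targs : Fin p → Ty V}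
    {args : Fin q → Expr V X} {σ : Ty V} {R : Sig V}
    (h : HasType D Δ Γ (.lit t targs args) σ) (hR : Offers D Δ σ R) :
    ∃ (d : MethodDecl) (targs' : Fin d.n → Ty V), Decl.method d ∈ D ∧
      Expr.lit t targs args = .lit d.recv targs' args ∧ R = d.sig.subst targs' ∧
      HasType D Δ Γ (.lit t targs args) (.struct d.recv targs') ∧
      (∀ i, TyOk D Δ (targs' i)) ∧
      ∀ i, IsSubtype D Δ (targs' i) ((d.bounds i).toTy.subst targs') := by
  obtain ⟨s, targs', args', hs, he, hok, hargs, hsub⟩ := h.lit_inv hD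
  cases he
  have hR' : Offers D Δ (.struct s.name targs') R := by
    cases hsub with
    | refl => exact hR
    | single hsub => exact hR.of_subtype_struct hD hsub
  exact hR'.exists_methodDecl (hok.of_struct hD hs) (.lit hs hok hargs)

theorem DeclsOk.hasType_body (hD : DeclsOk D) {d : MethodDecl} (hd : Decl.method d ∈ D) :
    HasType D d.tyEnv d.valEnv d.body d.sig.ret := by
  obtain ⟨_, _, h⟩ := hD.2 d hd
  cases h with
  | mk E h => exact ⟨_, h⟩

/-- Preservation. The condition on the type arguments of method calls is part of the invariant: it
is what makes the types substituted for the method's own type parameters well-formed. -/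
theorem Step.preservation (hD : DeclsOk D)
    (hDargs : ∀ d, Decl.method d ∈ D → d.body.CallTypeArgsOk D d.tyEnv)
    {e e' : Expr V X} {τ : Ty V} (hstep : Step D e e') (hok : e.CallTypeArgsOk D Δ)
    (h : HasType D Δ Γ e τ) : e'.CallTypeArgsOk D Δ ∧ HasType D Δ Γ e' τ := by
  induction hstep generalizing τ with
  | context C _ ih =>
    obtain ⟨hok, hfill⟩ := C.callTypeArgsOk_fill hok
    obtain ⟨σ, hσ, hfill'⟩ := C.hasType_fill hD h
    obtain ⟨h₁, h₂⟩ := ih hok hσ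
    exact ⟨hfill _ h₁, hfill' _ h₂⟩
  | field d hd targs vs hv i =>
    refine ⟨(hv i).callTypeArgsOk, ?_⟩
    obtain ⟨s, targs', j, hs, hf, hlit, hsub⟩ := h.sel_inv hD
    obtain ⟨args', he, hargs⟩ := hlit.lit_struct_inv hD hs
    obtain rfl := hD.struct_unique hd hs (by simp_all)
    obtain rfl := hD.fieldName_injective hd hf
    cases he
    exact (hargs i).sub hsub
  | call d hd targs us hu targs' vs hv =>
    obtain ⟨σ, R, targs₀, args₀, he, hr, hR, hb, ha, hsub⟩ := h.call_inv hD
    obtain ⟨d₀, targs₁, hd₀, hlit, rfl, hr', hok₁, hb₁⟩ := hr.lit_method hD hR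
    obtain rfl := hD.method_unique hd hd₀ (by simp_all) (Expr.call.inj he).2.1
    cases he
    cases hlit
    have inst_eq (σ : Ty (Fin d.n ⊕ Fin d.sig.nTy)) :
        (σ.subst (liftSubst d.sig.nTy targs)).subst (inst targs') =
          σ.subst (Sum.elim targs targs') := Ty.subst_liftSubst_inst targs targs' σ
    have hη : Conforms D d.tyEnv Δ (Sum.elim targs targs') := by
      rintro (i | j)
      · have h := hb₁ i
        simpa [MethodDecl.tyEnv, TyEnv.extend, IfaceTy.rename, IfaceTy.toTy_subst,
          Ty.subst_subst, Ty.subst] using h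
      · exact inst_eq (d.sig.bounds j).toTy ▸ hb j
    have hηok : ∀ α, TyOk D Δ (Sum.elim targs targs' α) := by
      rintro (i | j)
      · exact hok₁ i
      · exact hok.2.1 j
    refine ⟨(hDargs d hd).subst hD hη hηok ?_, ?_⟩
    · rintro (_ | k)
      · exact (IsValue.lit _ _ _ hu).callTypeArgsOk
      · exact (hv k).callTypeArgsOk
    · refine ((hD.hasType_body hd).subst hD hη hηok ?_).sub (inst_eq d.sig.ret ▸ hsub)
      rintro (_ | k)
      · exact hr'
      · exact inst_eq (d.sig.params k) ▸ ha k

/-! ### Progress -/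

theorem forall_isValue_or_exists_step {q : ℕ} {args : Fin q → Expr V X}
    (h : ∀ i, IsValue (args i) ∨ ∃ e', Step D (args i) e') :
    (∀ i, IsValue (args i)) ∨
      ∃ i, (∀ j, j < i → IsValue (args j)) ∧ ∃ e', Step D (args i) e' := by
  by_cases hv : ∀ i, IsValue (args i)
  · exact .inl hv
  · push Not at hv
    obtain ⟨i, hi, hmin⟩ := wellFounded_lt.has_min {i | ¬ IsValue (args i)} hv
    exact .inr ⟨i, fun j hj => by_contra fun hj' => hmin j hj' hj, (h i).resolve_left hi⟩

theorem HasType.progress (hD : DeclsOk D) {Γ : Empty → Ty V} {e : Expr V Empty} {τ : Ty V}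
    (h : HasType D Δ Γ e τ) : IsValue e ∨ ∃ e', Step D e e' := by
  induction e generalizing τ with
  | var x => exact x.elim
  | lit t targs args ih =>
    obtain ⟨d, targs', args', hd, he, -, hargs, -⟩ := h.lit_inv hD
    cases he
    rcases forall_isValue_or_exists_step fun i => ih i (hargs i) with hv | ⟨i, hv, e', he'⟩
    · exact .inl (.lit _ _ _ hv)
    · have := Step.context (.lit d.name targs' args' i hv .hole) he'
      simp only [EvalCtx.fill, Function.update_eq_self] at this
      exact .inr ⟨_, this⟩
  | sel e f ih =>
    obtain ⟨d, targs, i, hd, rfl, he, -⟩ := h.sel_inv hD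
    rcases ih he with hv | ⟨e', he'⟩
    · obtain ⟨t, targs', args, hv⟩ := hv
      obtain ⟨args', heq, -⟩ := he.lit_struct_inv hD hd
      cases heq
      exact .inr ⟨_, .field d hd _ _ hv i⟩
    · exact .inr ⟨_, .context (.sel .hole _) he'⟩
  | call e m targs args ih iha =>
    obtain ⟨σ, R, targs', args', he, hr, hR, -, ha, -⟩ := h.call_inv hD
    cases he
    rcases ih hr with hv | ⟨e', he'⟩
    · rcases forall_isValue_or_exists_step fun i => iha i (ha i) with hvs | ⟨i, hvs, e', he'⟩
      · obtain ⟨t, targs₀, us, hu⟩ := hv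
        obtain ⟨d, targs₁, hd, heq, rfl, -⟩ := hr.lit_method hD hR
        rw [heq]
        exact .inr ⟨_, .call d hd targs₁ us hu _ _ hvs⟩
      · have := Step.context (.callArg e hv R.name targs' args' i hvs .hole) he'
        simp only [EvalCtx.fill, Function.update_eq_self] at this
        exact .inr ⟨_, this⟩
    · exact .inr ⟨_, .context (.callRecv .hole _ _ _) he'⟩

/-- A typed expression without a reduction sequence of length `k` reduces to a value of its type. -/
theorem HasType.exists_value (hD : DeclsOk D)
    (hDargs : ∀ d, Decl.method d ∈ D → d.body.CallTypeArgsOk D d.tyEnv)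
    {Γ : Empty → Ty V} {τ : Ty V} (k : ℕ) {e : Expr V Empty} (hok : e.CallTypeArgsOk D Δ)
    (h : HasType D Δ Γ e τ) (hk : ¬ ∃ e', StepN D k e e') :
    ∃ v, IsValue v ∧ Reduces D e v ∧ HasType D Δ Γ v τ := by
  induction k generalizing e with
  | zero => exact (hk ⟨e, rfl⟩).elim
  | succ k ih =>
    rcases h.progress hD with hv | ⟨e₁, he₁⟩
    · exact ⟨e, hv, ⟨0, rfl⟩, h⟩
    · obtain ⟨hok₁, h₁⟩ := he₁.preservation hD hDargs hok h
      obtain ⟨v, hv, ⟨n, hn⟩, hvτ⟩ := ih hok₁ h₁ fun ⟨e', he'⟩ => hk ⟨e', e₁, he₁, he'⟩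
      exact ⟨v, hv, ⟨n + 1, e₁, he₁, hn⟩, hvτ⟩

end FGG

theorem mainTheorem4 (D : List FGG.Decl) (hD : FGG.DeclsOk D)
    (hDargs : ∀ d, FGG.Decl.method d ∈ D → d.body.CallTypeArgsOk D d.tyEnv)
    (e : FGG.Expr Empty Empty) (τ : FGG.Ty Empty) (E : FGG.TL (FGG.TLVar Empty Empty))
    (heargs : e.CallTypeArgsOk D FGG.emptyTyEnv)
    (he : FGG.ExpTrans D FGG.emptyTyEnv FGG.emptyValEnv e τ E) :
    (∃ v : FGG.Expr Empty Empty, FGG.IsValue v ∧ FGG.Reduces D e v ∧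
      ∃ E', FGG.ExpTrans D FGG.emptyTyEnv FGG.emptyValEnv v τ E') ∨
    FGG.Diverges D e := by
  by_cases h : FGG.Diverges D e
  · exact .inr h
  · obtain ⟨k, hk⟩ := not_forall.1 h
    exact .inl (FGG.HasType.exists_value hD hDargs k heargs ⟨E, he⟩ hk)
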